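/- Let $\tilde\omega=2\int_0^1\frac{dx}{\sqrt{1-x^4}}$, let $\wp$ be the Weierstrass function with period lattice $\mathbb{Z}\tilde\omega+\mathbb{Z}\,i\tilde\omega$, and define the Hurwitz numbers $\tilde H_n$ ($n\ge 2$) by the Laurent expansion about the origin $$\wp(z)=\frac1{z^2}+\sum_{n=2}^\infty \frac{2^n\tilde H_n}{n}\,\frac{z^{n-2}}{(n-2)!}.$$ Let $$f_1(\tau,t)=\frac{\cosh^2(\tau t/2)}{1-2e^{-t}\cosh(\tau t)+e^{-2t}},$$ and for an integer $n\ge 1$ put $$C_n^H=\int_0^\infty \frac1t\,e^{-t}f_1(i,t)\left[-1+{}_4F_3\!\left(\tfrac14-n,\tfrac12-n,\tfrac34-n,-n;\tfrac14,\tfrac12,\tfrac34;\frac{t^4}{\tilde\omega^4}\right)\right]dt,$$ where ${}_4F_3(a_1,\dots,a_4;b_1,b_2,b_3;x)=\sum_{k\ge0}\frac{(a_1)_k\cdots(a_4)_k}{(b_1)_k(b_2)_k(b_3)_k}\frac{x^k}{k!}$ is the generalized hypergeometric series, which terminates here because of the parameter $-n$. Then, for every integer $n\ge1$, this integral converges absolutely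 and $$\frac{4^{2n-1}}{8n}\,\tilde H_{4n}=C_n^H-\sum_{k=1}^{n-1}\binom{4n}{4k}\frac{4^{2k-1}}{8k}\,\tilde H_{4k}.$$ -/

import Mathlib

open MeasureTheory Set Filter Topology
open scoped Nat

noncomputable section

/-- The lemniscate period `2 ∫₀¹ dx / √(1 - x⁴)`. -/
def lemniscatePeriod : ℝ := 2 * ∫ x in (0 : ℝ)..1, 1 / Real.sqrt (1 - x ^ 4)

theorem lemniscatePeriod_pos : 0 < lemniscatePeriod := by
  have hint : IntervalIntegrable (fun x : ℝ => 1 / Real.sqrt (1 - x ^ 4)) volume 0 1 := by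
    have h1 : IntervalIntegrable (fun x : ℝ => (1 - x) ^ (-(1 / 2) : ℝ)) volume 0 1 := by
      have h := (intervalIntegral.intervalIntegrable_rpow' (a := 0) (b := 1)
        (r := -(1 / 2)) (by norm_num)).comp_sub_left 1
      simpa using h.symm
    refine h1.mono_fun (Measurable.aestronglyMeasurable (by fun_prop)) ?_
    rw [uIoc_of_le zero_le_one]
    filter_upwards [ae_restrict_mem measurableSet_Ioc] with x hx
    have hx0 : 0 ≤ 1 - x := by linarith [hx.2]
    rw [Real.rpow_neg hx0, ← Real.sqrt_eq_rpow, Real.norm_of_nonneg (by positivity),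
      Real.norm_of_nonneg (by positivity), one_div]
    rcases hx.2.eq_or_lt with rfl | hlt
    · simp
    · have h4 : x ^ 4 ≤ x := by
        simpa using pow_le_pow_of_le_one hx.1.le hx.2 (show 1 ≤ 4 by norm_num)
      have : 0 < Real.sqrt (1 - x) := Real.sqrt_pos.2 (by linarith)
      gcongr
  have hpos : 0 < ∫ x in (0 : ℝ)..1, 1 / Real.sqrt (1 - x ^ 4) := by
    refine intervalIntegral.intervalIntegral_pos_of_pos_on hint (fun x hx => ?_) zero_lt_one
    have : x ^ 4 < 1 := pow_lt_one₀ hx.1.le hx.2 (by norm_num)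
    have : 0 < Real.sqrt (1 - x ^ 4) := Real.sqrt_pos.2 (by linarith)
    positivity
  unfold lemniscatePeriod
  positivity

/-- The square period lattice spanned by `lemniscatePeriod` and `lemniscatePeriod * i`. -/
def lemniscatePeriodPair : PeriodPair where
  ω₁ := lemniscatePeriod
  ω₂ := lemniscatePeriod * Complex.I
  indep := by
    rw [LinearIndependent.pair_iff]
    intro s t h
    have hne := lemniscatePeriod_pos.ne'
    have hre := congrArg Complex.re h
    have him := congrArg Complex.im h
    simp at hre him
    exact ⟨hre.resolve_right hne, him.resolve_right hne⟩

/-- The Hurwitz numbers: `2 ^ n * H n / n` is, for `n ≥ 2`, the `(n - 2)`-nd Taylor coefficient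
times `(n - 2)!`, at the origin, of the regular part `℘ z - 1 / z ^ 2` (extended over `z = 0`) of
the Weierstrass function `℘` of the lattice above; see `hurwitzNumber_laurent`. -/
def hurwitzNumber (n : ℕ) : ℂ :=
  n / 2 ^ n * iteratedDeriv (n - 2) (lemniscatePeriodPair.weierstrassPExcept 0) 0

/-- The Laurent expansion `℘ z = 1 / z ^ 2 + ∑ (n ≥ 2), (2 ^ n * H n / n) * z ^ (n - 2) / (n - 2)!`
in a punctured neighbourhood of the origin (the summation index is shifted by two). -/
theorem hurwitzNumber_laurent : ∀ᶠ z in 𝓝[≠] (0 : ℂ),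
    HasSum (fun m : ℕ =>
        2 ^ (m + 2) * hurwitzNumber (m + 2) / ((m + 2 : ℕ) : ℂ) * (z ^ m / (m ! : ℂ)))
      (lemniscatePeriodPair.weierstrassP z - 1 / z ^ 2) := by
  have h := (lemniscatePeriodPair.analyticAt_weierstrassPExcept 0).hasFPowerSeriesAt.eventually_hasSum
  filter_upwards [h.filter_mono nhdsWithin_le_nhds] with z hz
  have he := lemniscatePeriodPair.weierstrassPExcept_def (0 : lemniscatePeriodPair.lattice) z
  simp only [ZeroMemClass.coe_zero, sub_zero, zero_add] at he hz
  have he' : lemniscatePeriodPair.weierstrassP z - 1 / z ^ 2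
      = lemniscatePeriodPair.weierstrassPExcept 0 z := by
    rw [he]; simp [sub_eq_add_neg]
  rw [he']
  have key : ∀ m : ℕ, 2 ^ (m + 2) * hurwitzNumber (m + 2) / ((m + 2 : ℕ) : ℂ) *
        (z ^ m / (m ! : ℂ)) =
      (FormalMultilinearSeries.ofScalars (𝕜 := ℂ) ℂ (fun n : ℕ =>
        iteratedDeriv n (lemniscatePeriodPair.weierstrassPExcept 0) 0 / (n ! : ℂ)) m)
          (fun _ : Fin m => z) := by
    intro m
    have h2 : ((m + 2 : ℕ) : ℂ) ≠ 0 := by exact_mod_cast Nat.succ_ne_zero (m + 1)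
    have hm : (m ! : ℂ) ≠ 0 := by exact_mod_cast Nat.factorial_ne_zero m
    simp only [hurwitzNumber, Nat.add_sub_cancel,
      FormalMultilinearSeries.apply_eq_prod_smul_coeff, FormalMultilinearSeries.coeff_ofScalars,
      Finset.prod_const, Finset.card_univ, Fintype.card_fin, smul_eq_mul]
    field_simp
  simp only [key]
  exact hz

/-- `f₁(τ, t) = cosh²(τ t / 2) / (1 - 2 e^{-t} cosh(τ t) + e^{-2t})`. -/
def kernelF1 (τ : ℂ) (t : ℝ) : ℂ :=
  Complex.cosh (τ * t / 2) ^ 2 /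
    (1 - 2 * Complex.exp (-t) * Complex.cosh (τ * t) + Complex.exp (-2 * t))

/-- The generalized hypergeometric series `pFq(a₁, …, a_p; b₁, …, b_q; z)`; `(x)_k` is the rising
factorial `ascPochhammer`. If some `aᵢ` is a nonpositive integer (and no `bⱼ` is), the series has
only finitely many nonzero terms. -/
def generalizedHypergeometric (a b : List ℂ) (z : ℂ) : ℂ :=
  ∑' k : ℕ, (a.map fun x => (ascPochhammer ℂ k).eval x).prod /
    (b.map fun x => (ascPochhammer ℂ k).eval x).prod * (z ^ k / (k ! : ℂ))

/-- The integrand of the constant `C_n^H`. -/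
def hurwitzIntegrand (n : ℕ) (t : ℝ) : ℂ :=
  1 / (t : ℂ) * Complex.exp (-t) * kernelF1 Complex.I t *
    (-1 + generalizedHypergeometric [1 / 4 - (n : ℂ), 1 / 2 - (n : ℂ), 3 / 4 - (n : ℂ), -(n : ℂ)]
      [1 / 4, 1 / 2, 3 / 4] ((t : ℂ) ^ 4 / (lemniscatePeriod : ℂ) ^ 4))

/-- The constant `C_n^H`. -/
def hurwitzConstant (n : ℕ) : ℂ := ∫ t in Ioi (0 : ℝ), hurwitzIntegrand n t

end

/-!
The lattice of `℘` is `lemniscatePeriod • ℤ[i]`, so its Taylor coefficients identify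
`4 ^ (2k - 1) / (8k) * H₄ₖ` with `(4k - 1)! / 8 * ∑ ω⁻⁴ᵏ`, the sum running over the nonzero periods
(`hurwitzNumber_four_mul`). On the other side the hypergeometric polynomial is
`∑ₖ (4n choose 4k) zᵏ` (`generalizedHypergeometric_quarters`), so `hurwitzConstant n` is a
combination of the moments `∫ t ^ (4k - 1) e⁻ᵗ f₁(i, t) dt` with `1 ≤ k ≤ n`. The recurrence therefore
amounts to evaluating these moments: `hurwitzConstant n` is the full sum over `1 ≤ k ≤ n`, and the
term `k = n` is the left-hand side.

The denominator of `f₁(i, t)` is `(1 - e^{-t(1+i)}) (1 - e^{-t(1-i)})`. Expanding both factors as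
geometric series shows that `e⁻ᵗ f₁(i, t)` is half of the sum of `e^{-tω}` over the Gaussian integers
`ω = x + y i` in the sector `|y| ≤ x`, `x > 0`, with weight `1 / 2` on the boundary rays
(`exp_mul_kernelF1`, `hasSum_coneKernel`); the weighted sector is the cone with apex `1` plus half
of each of the cones with apexes `1 + i` and `1 - i`. Integrating termwise gives half of `(4k - 1)! ∑ ω⁻⁴ᵏ` over
the weighted sector. As `ω⁻⁴ᵏ` is invariant under `ω ↦ i ω` and four quarter turns of the sector tile
the punctured plane (`tsum_eq_four_mul_cone`), this is one eighth of the full lattice sum. For `k ≥ 1`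
the exponent `4k ≥ 4` exceeds the rank of the lattice, which makes everything absolutely convergent.
-/

/-! ### The hypergeometric polynomial -/

/-- Multiplication formula for Pochhammer symbols: the residue classes modulo four of the factors of
`(-4n)₄ₖ = 4n (4n - 1) ⋯` and of `(1)₄ₖ = (4k)!` give the quarter-integer parameters. -/
theorem ascPochhammer_quarters_mul_factorial (n k : ℕ) :
    (ascPochhammer ℂ k).eval (1 / 4 - (n : ℂ)) * (ascPochhammer ℂ k).eval (1 / 2 - (n : ℂ)) *
        (ascPochhammer ℂ k).eval (3 / 4 - (n : ℂ)) * (ascPochhammer ℂ k).eval (-(n : ℂ)) *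
        ((4 * k)! : ℂ) =
      (descPochhammer ℂ (4 * k)).eval ((4 * n : ℕ) : ℂ) * ((ascPochhammer ℂ k).eval (1 / 4 : ℂ) *
        (ascPochhammer ℂ k).eval (1 / 2 : ℂ) * (ascPochhammer ℂ k).eval (3 / 4 : ℂ) * (k ! : ℂ)) := by
  induction k with
  | zero => simp
  | succ k ih =>
    rw [show 4 * (k + 1) = 4 * k + 1 + 1 + 1 + 1 by ring]
    simp only [ascPochhammer_succ_eval, descPochhammer_succ_eval, Nat.factorial_succ]
    push_cast at ih ⊢
    linear_combination ((1 / 4 - (n : ℂ) + k) * (1 / 2 - n + k) * (3 / 4 - n + k) * (-n + k) *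
      (4 * k + 1) * (4 * k + 2) * (4 * k + 3) * (4 * k + 4)) * ih

theorem ascPochhammer_eval_ne_zero {x : ℝ} (hx : 0 < x) (k : ℕ) :
    (ascPochhammer ℂ k).eval (x : ℂ) ≠ 0 := by
  induction k with
  | zero => simp
  | succ k ih =>
    rw [ascPochhammer_succ_eval]
    refine mul_ne_zero ih ?_
    have : x + k ≠ 0 := by positivity
    exact_mod_cast this

theorem generalizedHypergeometric_quarters (n : ℕ) (z : ℂ) :
    generalizedHypergeometric [1 / 4 - (n : ℂ), 1 / 2 - (n : ℂ), 3 / 4 - (n : ℂ), -(n : ℂ)]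
      [1 / 4, 1 / 2, 3 / 4] z = 1 + ∑ k ∈ Finset.Icc 1 n, ((4 * n).choose (4 * k) : ℂ) * z ^ k := by
  have key (k : ℕ) : (([1 / 4 - (n : ℂ), 1 / 2 - (n : ℂ), 3 / 4 - (n : ℂ), -(n : ℂ)] : List ℂ).map
        fun x => (ascPochhammer ℂ k).eval x).prod /
      (([1 / 4, 1 / 2, 3 / 4] : List ℂ).map fun x => (ascPochhammer ℂ k).eval x).prod *
        (z ^ k / (k ! : ℂ)) = ((4 * n).choose (4 * k) : ℂ) * z ^ k := by
    have h := ascPochhammer_quarters_mul_factorial n k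
    rw [descPochhammer_eval_eq_descFactorial, Nat.descFactorial_eq_factorial_mul_choose] at h
    have h1 : (ascPochhammer ℂ k).eval (1 / 4 : ℂ) ≠ 0 := by
      simpa using ascPochhammer_eval_ne_zero (x := 1 / 4) (by norm_num) k
    have h2 : (ascPochhammer ℂ k).eval (1 / 2 : ℂ) ≠ 0 := by
      simpa using ascPochhammer_eval_ne_zero (x := 1 / 2) (by norm_num) k
    have h3 : (ascPochhammer ℂ k).eval (3 / 4 : ℂ) ≠ 0 := by
      simpa using ascPochhammer_eval_ne_zero (x := 3 / 4) (by norm_num) k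
    have h4 : ((4 * k)! : ℂ) ≠ 0 := by exact_mod_cast Nat.factorial_ne_zero _
    have h5 : (k ! : ℂ) ≠ 0 := by exact_mod_cast Nat.factorial_ne_zero _
    push_cast at h
    simp only [List.map_cons, List.map_nil, List.prod_cons, List.prod_nil, mul_one]
    generalize (ascPochhammer ℂ k).eval (1 / 4 : ℂ) = a at *
    generalize (ascPochhammer ℂ k).eval (1 / 2 : ℂ) = b at *
    generalize (ascPochhammer ℂ k).eval (3 / 4 : ℂ) = c at *
    rw [div_mul_div_comm, div_eq_iff (by positivity)]
    apply mul_right_cancel₀ h4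
    linear_combination z ^ k * h
  rw [generalizedHypergeometric]
  simp only [key]
  rw [tsum_eq_sum (s := Finset.range (n + 1)), Finset.sum_range_succ', add_comm]
  · rw [Finset.range_eq_Ico, Finset.sum_Ico_add' (fun k => ((4 * n).choose (4 * k) : ℂ) * z ^ k)]
    simp only [mul_zero, Nat.choose_zero_right, Nat.cast_one, pow_zero, mul_one, zero_add]
    rfl
  · intro k hk
    rw [Nat.choose_eq_zero_of_lt (by simp at hk; lia)]
    simp

/-! ### Sums over the Gaussian integers -/

/-- The Gaussian integer `x + y i` as a complex number. -/
noncomputable def gaussianInt (p : ℤ × ℤ) : ℂ := p.1 + p.2 * Complex.I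

/-- Multiplication by `i` on pairs `(x, y)` representing `x + y i`. -/
def quarterTurn : ℤ × ℤ ≃ ℤ × ℤ where
  toFun p := (-p.2, p.1)
  invFun p := (p.2, -p.1)
  left_inv p := by simp
  right_inv p := by simp

theorem gaussianInt_quarterTurn (p : ℤ × ℤ) :
    gaussianInt (quarterTurn p) = Complex.I * gaussianInt p := by
  simp only [gaussianInt, quarterTurn, Equiv.coe_fn_mk]
  push_cast
  linear_combination (-p.2 : ℂ) * Complex.I_mul_I

/-- The points `1 + d i + m (1 + i) + n (1 - i)` with `m, n ≥ 0`: the cone spanned by `1 + i` and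
`1 - i`, translated to have its apex at `1 + d i`. -/
def conePoint (d : ℤ) (v : ℕ × ℕ) : ℤ × ℤ := (v.1 + v.2 + 1, v.1 - v.2 + d)

theorem conePoint_injective (d : ℤ) : Function.Injective (conePoint d) := by
  rintro ⟨a, b⟩ ⟨a', b'⟩ h
  simp only [conePoint, Prod.mk.injEq] at h ⊢
  lia

/-- A cone is cut out by two inequalities and a parity: `1 + i` and `1 - i` generate the even
Gaussian integers, those with `x + y` even. -/
theorem mem_range_conePoint {d : ℤ} {p : ℤ × ℤ} :
    p ∈ range (conePoint d) ↔ -p.1 < p.2 - d ∧ p.2 - d < p.1 ∧ (p.1 + p.2 + d) % 2 = 1 := by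
  obtain ⟨x, y⟩ := p
  constructor
  · rintro ⟨⟨a, b⟩, h⟩
    simp only [conePoint, Prod.mk.injEq] at h ⊢
    lia
  · rintro ⟨h1, h2, h3⟩
    simp only at h1 h2 h3
    refine ⟨(((x - 1 + (y - d)) / 2).toNat, ((x - 1 - (y - d)) / 2).toNat), ?_⟩
    simp only [conePoint, Prod.mk.injEq]
    lia

open Classical in
/-- The weight that is `1` in the open sector `|y| < x`, `1 / 2` on its two bounding rays and `0`
elsewhere. -/
noncomputable def sectorWeight (p : ℤ × ℤ) : ℂ :=
  (if p ∈ range (conePoint 0) then 1 else 0) + (if p ∈ range (conePoint 1) then 1 else 0) / 2 +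
    (if p ∈ range (conePoint (-1)) then 1 else 0) / 2

theorem sectorWeight_eq (p : ℤ × ℤ) :
    sectorWeight p = if -p.1 < p.2 ∧ p.2 < p.1 then 1 else
      if (p.1 = p.2 ∨ p.1 = -p.2) ∧ 0 < p.1 then 1 / 2 else 0 := by
  simp only [sectorWeight, mem_range_conePoint]
  split_ifs <;> first | (exfalso; lia) | norm_num

theorem sum_sectorWeight_quarterTurn {p : ℤ × ℤ} (hp : p ≠ 0) :
    sectorWeight p + sectorWeight (quarterTurn p) + sectorWeight (quarterTurn (quarterTurn p)) +
      sectorWeight (quarterTurn (quarterTurn (quarterTurn p))) = 1 := by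
  obtain ⟨x, y⟩ := p
  have hxy : ¬ (x = 0 ∧ y = 0) := fun h => hp (by simp [h])
  simp only [sectorWeight_eq, quarterTurn, Equiv.coe_fn_mk]
  split_ifs <;> first | (exfalso; lia) | norm_num

theorem tsum_sectorWeight {g : ℤ × ℤ → ℂ} (hg : Summable g) :
    ∑' p, sectorWeight p * g p = ∑' v, g (conePoint 0 v) + (∑' v, g (conePoint 1 v)) / 2 +
      (∑' v, g (conePoint (-1) v)) / 2 := by
  classical
  have h (d : ℤ) : HasSum ((range (conePoint d)).indicator g) (∑' v, g (conePoint d v)) := by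
    rw [← hasSum_subtype_iff_indicator]
    exact (conePoint_injective d).hasSum_range_iff.2
      (hg.comp_injective (conePoint_injective d)).hasSum
  refine HasSum.tsum_eq ?_
  convert ((h 0).add ((h 1).div_const 2)).add ((h (-1)).div_const 2) using 2 with p
  simp only [sectorWeight, indicator_apply]
  split_ifs <;> ring

theorem summable_sectorWeight_mul {g : ℤ × ℤ → ℂ} (hg : Summable g) :
    Summable fun p => sectorWeight p * g p := by
  refine Summable.of_norm_bounded hg.norm fun p => ?_
  rw [norm_mul]
  refine mul_le_of_le_one_left (norm_nonneg _) ?_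
  rw [sectorWeight_eq]
  split_ifs <;> norm_num

/-- The four quarter turns of the sector tile the punctured plane, so a rotation invariant sum
over `ℤ[i] ∖ {0}` is four times the weighted sum over the sector. -/
theorem tsum_eq_four_mul_cone {g : ℤ × ℤ → ℂ} (hg : Summable g) (h0 : g 0 = 0)
    (hrot : ∀ p, g (quarterTurn p) = g p) :
    ∑' p, g p = 4 * (∑' v, g (conePoint 0 v) + (∑' v, g (conePoint 1 v)) / 2 +
      (∑' v, g (conePoint (-1) v)) / 2) := by
  rw [← tsum_sectorWeight hg]
  set w : ℤ × ℤ → ℂ := fun p => sectorWeight p * g p with hw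
  have h1 : HasSum w (∑' p, w p) := (summable_sectorWeight_mul hg).hasSum
  have step {f : ℤ × ℤ → ℂ} (hf : HasSum f (∑' p, w p)) :
      HasSum (fun p => f (quarterTurn p)) (∑' p, w p) := quarterTurn.hasSum_iff.2 hf
  have h2 := step h1
  have h3 := step h2
  have h4 := step h3
  refine HasSum.tsum_eq ?_
  convert ((h1.add h2).add h3).add h4 using 1
  · funext p
    simp only [hw, hrot]
    rcases eq_or_ne p 0 with rfl | hp
    · simp [h0]
    · linear_combination (-g p) * sum_sectorWeight_quarterTurn hp
  · ring

/-! ### Termwise integration over the cones -/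

/-- A pointwise sum of functions with summable `L¹` norms is integrable. -/
theorem MeasureTheory.Integrable.of_summable_integral_norm {α ι E : Type*} [MeasurableSpace α]
    {μ : Measure α} [Countable ι] [NormedAddCommGroup E] {F : ι → α → E} {f : α → E}
    (hF : ∀ i, Integrable (F i) μ) (hsum : Summable fun i => ∫ a, ‖F i a‖ ∂μ)
    (hf : AEStronglyMeasurable f μ) (hFf : ∀ᵐ a ∂μ, HasSum (fun i => F i a) (f a)) :
    Integrable f μ := by
  refine ⟨hf, ?_⟩
  have hfin : ∑' i, ∫⁻ a, ‖F i a‖ₑ ∂μ < ⊤ := by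
    have (i : ι) : ∫⁻ a, ‖F i a‖ₑ ∂μ = ENNReal.ofReal (∫ a, ‖F i a‖ ∂μ) :=
      (ofReal_integral_norm_eq_lintegral_enorm (hF i)).symm
    simp only [this]
    exact hsum.tsum_ofReal_lt_top
  refine lt_of_le_of_lt ?_ hfin
  rw [← lintegral_tsum fun i => (hF i).1.enorm]
  refine lintegral_mono_ae ?_
  filter_upwards [hFf] with a ha
  rw [← ha.tsum_eq]
  exact enorm_tsum_le_tsum_enorm

theorem norm_pow_mul_cexp_neg_mul {t : ℝ} (ht : 0 < t) (r : ℕ) (z : ℂ) :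
    ‖(t : ℂ) ^ r * Complex.exp (-(t * z))‖ = t ^ ((r + 1 : ℝ) - 1) * Real.exp (-(z.re * t)) := by
  rw [norm_mul, norm_pow, Complex.norm_real, Real.norm_of_nonneg ht.le, Complex.norm_exp,
    add_sub_cancel_right, Real.rpow_natCast]
  simp [mul_comm]

theorem integrableOn_pow_mul_cexp_neg_mul (r : ℕ) {z : ℂ} (hz : 0 < z.re) :
    IntegrableOn (fun t : ℝ => (t : ℂ) ^ r * Complex.exp (-(t * z))) (Ioi 0) := by
  have h := integrableOn_rpow_mul_exp_neg_mul_rpow (p := 1) (s := (r + 1 : ℝ) - 1) (b := z.re)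
    (by linarith [(Nat.cast_nonneg r : (0 : ℝ) ≤ r)]) one_pos hz
  refine Integrable.mono' h (Continuous.aestronglyMeasurable (by fun_prop)) ?_
  filter_upwards [ae_restrict_mem measurableSet_Ioi] with t ht
  rw [norm_pow_mul_cexp_neg_mul ht, Real.rpow_one, neg_mul]

theorem integral_norm_pow_mul_cexp_neg_mul (r : ℕ) {z : ℂ} (hz : 0 < z.re) :
    ∫ t : ℝ in Ioi 0, ‖(t : ℂ) ^ r * Complex.exp (-(t * z))‖ = r ! * (1 / z.re) ^ (r + 1) := by
  rw [setIntegral_congr_fun measurableSet_Ioi fun t ht => norm_pow_mul_cexp_neg_mul ht r z,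
    Real.integral_rpow_mul_exp_neg_mul_Ioi (by positivity) hz, Real.Gamma_nat_eq_factorial, mul_comm]
  norm_cast

theorem integral_pow_mul_cexp_neg_mul (r : ℕ) {z : ℂ} (hz : 0 < z.re) :
    ∫ t : ℝ in Ioi 0, (t : ℂ) ^ r * Complex.exp (-(t * z)) = r ! * (z ^ (r + 1))⁻¹ := by
  have hz0 : z ≠ 0 := fun h => by simp [h] at hz
  induction r with
  | zero =>
    have h := integral_exp_mul_complex_Ioi (a := -z) (by simpa using hz) 0
    simp only [neg_mul, Complex.ofReal_zero, mul_zero, Complex.exp_zero] at h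
    simp only [pow_zero, one_mul, mul_comm _ z, h]
    simp
  | succ r ih =>
    have hd (t : ℝ) : HasDerivAt (fun t : ℝ => (t : ℂ) ^ (r + 1) * Complex.exp (-(t * z)))
        (((r + 1 : ℕ) : ℂ) * ((t : ℂ) ^ r * Complex.exp (-(t * z))) -
          z * ((t : ℂ) ^ (r + 1) * Complex.exp (-(t * z)))) t := by
      have h1 : HasDerivAt (fun t : ℝ => (t : ℂ)) 1 t := Complex.ofRealCLM.hasDerivAt
      have h2 := (h1.fun_pow (r + 1)).mul (h1.mul_const z).fun_neg.cexp
      refine h2.congr_deriv ?_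
      rw [Nat.add_sub_cancel]
      push_cast
      ring
    have hlim : Tendsto (fun t : ℝ => (t : ℂ) ^ (r + 1) * Complex.exp (-(t * z))) atTop (𝓝 0) := by
      rw [tendsto_zero_iff_norm_tendsto_zero]
      refine (tendsto_rpow_mul_exp_neg_mul_atTop_nhds_zero (((r + 1 : ℕ) + 1 : ℝ) - 1) z.re
        hz).congr' ?_
      filter_upwards [eventually_gt_atTop 0] with t ht
      rw [norm_pow_mul_cexp_neg_mul ht, neg_mul]
    have i1 := (integrableOn_pow_mul_cexp_neg_mul r hz).const_mul ((r + 1 : ℕ) : ℂ)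
    have i2 := (integrableOn_pow_mul_cexp_neg_mul (r + 1) hz).const_mul z
    have h := integral_Ioi_of_hasDerivAt_of_tendsto' (a := 0) (fun t _ => hd t) (i1.sub i2) hlim
    rw [integral_sub i1 i2, integral_const_mul, integral_const_mul, ih] at h
    simp only [Complex.ofReal_zero, zero_pow (Nat.succ_ne_zero r), zero_mul, sub_zero] at h
    rw [Nat.factorial_succ]
    apply mul_left_cancel₀ hz0
    rw [← sub_eq_zero.1 h]
    push_cast
    field_simp
    ring

theorem re_gaussianInt_conePoint (d : ℤ) (v : ℕ × ℕ) :
    (gaussianInt (conePoint d v)).re = v.1 + v.2 + 1 := by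
  simp [gaussianInt, conePoint]

theorem summable_inv_add_add_one_pow {r : ℕ} (hr : 4 ≤ r) :
    Summable fun v : ℕ × ℕ => (1 / ((v.1 : ℝ) + v.2 + 1)) ^ r := by
  have h : Summable fun m : ℕ => 1 / ((m : ℝ) + 1) ^ 2 := by
    have := (summable_nat_add_iff 1).2 (Real.summable_one_div_nat_pow.2 one_lt_two)
    simpa using this
  refine Summable.of_nonneg_of_le (fun v => by positivity) (fun v => ?_)
    (h.mul_of_nonneg h (fun _ => by positivity) fun _ => by positivity)
  obtain ⟨a, b⟩ := v
  have ha : (0 : ℝ) ≤ a := Nat.cast_nonneg a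
  have hb : (0 : ℝ) ≤ b := Nat.cast_nonneg b
  -- `(a + b + 1)⁴ ≥ (a + 1)² (b + 1)²` gives a product of two convergent series as majorant.
  calc (1 / ((a : ℝ) + b + 1)) ^ r ≤ (1 / ((a : ℝ) + b + 1)) ^ 4 :=
        pow_le_pow_of_le_one (by positivity) ((div_le_one (by positivity)).2 (by linarith)) hr
    _ = 1 / (((a : ℝ) + b + 1) ^ 2 * ((a : ℝ) + b + 1) ^ 2) := by rw [div_pow, one_pow]; ring_nf
    _ ≤ 1 / (((a : ℝ) + 1) ^ 2 * ((b : ℝ) + 1) ^ 2) := by gcongr <;> linarith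
    _ = _ := by rw [one_div_mul_one_div]

/-- The exponential sum `∑ exp (-t ω)` over the points `ω` of the cone with apex `1 + d i`, in closed
form as a product of two geometric series. -/
noncomputable def coneKernel (d : ℤ) (t : ℝ) : ℂ :=
  Complex.exp (-(t * (1 + d * Complex.I))) *
    ((1 - Complex.exp (-(t * (1 + Complex.I))))⁻¹ * (1 - Complex.exp (-(t * (1 - Complex.I))))⁻¹)

theorem norm_cexp_neg_mul_lt_one {t : ℝ} (ht : 0 < t) {z : ℂ} (hz : z.re = 1) :
    ‖Complex.exp (-(t * z))‖ < 1 := by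
  rw [Complex.norm_exp]
  simpa [hz] using ht

theorem hasSum_coneKernel (d : ℤ) {t : ℝ} (ht : 0 < t) :
    HasSum (fun v => Complex.exp (-(t * gaussianInt (conePoint d v)))) (coneKernel d t) := by
  have hp := norm_cexp_neg_mul_lt_one ht (z := 1 + Complex.I) (by simp)
  have hq := norm_cexp_neg_mul_lt_one ht (z := 1 - Complex.I) (by simp)
  have h := ((hasSum_geometric_of_norm_lt_one hp).mul (hasSum_geometric_of_norm_lt_one hq)
    (summable_mul_of_summable_norm (summable_norm_geometric_of_norm_lt_one hp)
      (summable_norm_geometric_of_norm_lt_one hq))).mul_left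
        (Complex.exp (-(t * (1 + d * Complex.I))))
  refine h.congr_fun fun v => ?_
  rw [← Complex.exp_nat_mul, ← Complex.exp_nat_mul, ← Complex.exp_add, ← Complex.exp_add]
  congr 1
  simp only [gaussianInt, conePoint]
  push_cast
  ring

theorem summable_integral_norm_cone (d : ℤ) {r : ℕ} (hr : 3 ≤ r) :
    Summable fun v => ∫ t : ℝ in Ioi 0,
      ‖(t : ℂ) ^ r * Complex.exp (-(t * gaussianInt (conePoint d v)))‖ := by
  refine ((summable_inv_add_add_one_pow (r := r + 1) (by lia)).mul_left (r ! : ℝ)).congr fun v => ?_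
  rw [integral_norm_pow_mul_cexp_neg_mul r (by rw [re_gaussianInt_conePoint]; positivity),
    re_gaussianInt_conePoint]

theorem integrableOn_pow_mul_cone (d : ℤ) (r : ℕ) (v : ℕ × ℕ) :
    IntegrableOn (fun t : ℝ => (t : ℂ) ^ r * Complex.exp (-(t * gaussianInt (conePoint d v))))
      (Ioi 0) :=
  integrableOn_pow_mul_cexp_neg_mul r (by rw [re_gaussianInt_conePoint]; positivity)

theorem integrableOn_pow_mul_coneKernel (d : ℤ) {r : ℕ} (hr : 3 ≤ r) :
    IntegrableOn (fun t : ℝ => (t : ℂ) ^ r * coneKernel d t) (Ioi 0) := by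
  refine Integrable.of_summable_integral_norm (integrableOn_pow_mul_cone d r)
    (summable_integral_norm_cone d hr) ?_ ?_
  · unfold coneKernel
    exact Measurable.aestronglyMeasurable (by fun_prop)
  · filter_upwards [ae_restrict_mem measurableSet_Ioi] with t ht
    exact (hasSum_coneKernel d ht).mul_left _

theorem integral_pow_mul_coneKernel (d : ℤ) {r : ℕ} (hr : 3 ≤ r) :
    ∫ t : ℝ in Ioi 0, (t : ℂ) ^ r * coneKernel d t =
      r ! * ∑' v, (gaussianInt (conePoint d v) ^ (r + 1))⁻¹ := by
  have h := integral_tsum_of_summable_integral_norm (integrableOn_pow_mul_cone d r)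
    (summable_integral_norm_cone d hr)
  rw [← tsum_mul_left, setIntegral_congr_fun measurableSet_Ioi fun (t : ℝ) (ht : 0 < t) =>
    ((hasSum_coneKernel d ht).mul_left ((t : ℂ) ^ r)).tsum_eq.symm, ← h]
  refine tsum_congr fun v => ?_
  rw [integral_pow_mul_cexp_neg_mul r (by rw [re_gaussianInt_conePoint]; positivity)]

/-- The kernel `e⁻ᵗ f₁(i, t)` is half the exponential sum over the closed sector `|y| ≤ x` of the
Gaussian integers, the two bounding rays counting half. -/
theorem exp_mul_kernelF1 (t : ℝ) :
    Complex.exp (-t) * kernelF1 Complex.I t =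
      coneKernel 0 t / 2 + coneKernel 1 t / 4 + coneKernel (-1) t / 4 := by
  have hadd (z : ℂ) : Complex.exp (-(t * (1 + z))) = Complex.exp (-t) * Complex.exp (-(t * z)) := by
    rw [← Complex.exp_add]; ring_nf
  have hinv : Complex.exp (-(t * -Complex.I)) * Complex.exp (-(t * Complex.I)) = 1 := by
    rw [← Complex.exp_add]; simp
  have hsq : Complex.exp (-2 * t) = Complex.exp (-t) * Complex.exp (-t) := by
    rw [← Complex.exp_add]; ring_nf
  have hc : Complex.cosh (Complex.I * t) =
      (Complex.exp (-(t * -Complex.I)) + Complex.exp (-(t * Complex.I))) / 2 := by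
    rw [Complex.cosh]; ring_nf
  have hc2 : Complex.cosh (Complex.I * t / 2) ^ 2 = (Complex.cosh (Complex.I * t) + 1) / 2 := by
    have := Complex.cosh_sq (Complex.I * t / 2)
    have h2 := Complex.cosh_two_mul (Complex.I * t / 2)
    rw [mul_div_cancel₀ _ two_ne_zero] at h2
    linear_combination (1 / 2 : ℂ) * this - (1 / 2 : ℂ) * h2
  simp only [kernelF1, coneKernel, hc2, hc, hsq, sub_eq_add_neg (1 : ℂ) Complex.I, hadd, ← mul_inv]
  rw [div_eq_mul_inv, show (1 - Complex.exp (-t) * Complex.exp (-(t * Complex.I))) *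
      (1 - Complex.exp (-t) * Complex.exp (-(t * -Complex.I))) =
    1 - 2 * Complex.exp (-t) * ((Complex.exp (-(t * -Complex.I)) +
      Complex.exp (-(t * Complex.I))) / 2) + Complex.exp (-t) * Complex.exp (-t) by
    linear_combination Complex.exp (-t) * Complex.exp (-t) * hinv]
  push_cast
  simp only [zero_mul, mul_zero, neg_zero, Complex.exp_zero, one_mul, neg_one_mul]
  ring

/-! ### The lattice sums and the Hurwitz numbers -/

theorem summable_and_tsum_gaussianInt {r : ℕ} (hr : 3 ≤ r) :
    Summable (fun p => (gaussianInt p ^ r)⁻¹) ∧ ∑' p, (gaussianInt p ^ r)⁻¹ =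
      (lemniscatePeriod : ℂ) ^ r * lemniscatePeriodPair.sumInvPow 0 r := by
  have hω : (lemniscatePeriod : ℂ) ≠ 0 := by exact_mod_cast lemniscatePeriod_pos.ne'
  have h := (lemniscatePeriodPair.hasSum_sumInvPow 0 (r := r) hr).mul_left
    ((lemniscatePeriod : ℂ) ^ r)
  rw [← lemniscatePeriodPair.latticeEquivProd.symm.toEquiv.hasSum_iff] at h
  have h' : HasSum (fun p => (gaussianInt p ^ r)⁻¹)
      ((lemniscatePeriod : ℂ) ^ r * lemniscatePeriodPair.sumInvPow 0 r) := by
    refine h.congr_fun fun p => ?_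
    have hp : ((lemniscatePeriodPair.latticeEquivProd.symm p : lemniscatePeriodPair.lattice) : ℂ) =
        lemniscatePeriod * gaussianInt p := by
      rw [PeriodPair.latticeEquiv_symm_apply]
      simp only [lemniscatePeriodPair, gaussianInt]
      ring
    change _ = (lemniscatePeriod : ℂ) ^ r *
      (((lemniscatePeriodPair.latticeEquivProd.symm p : lemniscatePeriodPair.lattice) - 0 : ℂ) ^ r)⁻¹
    rw [hp, sub_zero, mul_pow, mul_inv, mul_inv_cancel_left₀ (pow_ne_zero _ hω)]
  exact ⟨h'.summable, h'.tsum_eq⟩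

theorem integrableOn_pow_mul_exp_mul_kernelF1 {r : ℕ} (hr : 3 ≤ r) :
    IntegrableOn (fun t : ℝ => (t : ℂ) ^ r * (Complex.exp (-t) * kernelF1 Complex.I t)) (Ioi 0) := by
  refine ((((integrableOn_pow_mul_coneKernel 0 hr).div_const 2).add
    ((integrableOn_pow_mul_coneKernel 1 hr).div_const 4)).add
    ((integrableOn_pow_mul_coneKernel (-1) hr).div_const 4)).congr (.of_forall fun t => ?_)
  simp only [Pi.add_apply, exp_mul_kernelF1]
  ring

/-- Divisibility of the exponent by four makes the summand `ω⁻⁴ᵏ` invariant under `ω ↦ i ω`, so that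
the sector sum given by the kernel is a quarter of the full lattice sum. -/
theorem integral_pow_mul_exp_mul_kernelF1 {k : ℕ} (hk : 1 ≤ k) :
    ∫ t : ℝ in Ioi 0, (t : ℂ) ^ (4 * k - 1) * (Complex.exp (-t) * kernelF1 Complex.I t) =
      (4 * k - 1)! / 8 *
        ((lemniscatePeriod : ℂ) ^ (4 * k) * lemniscatePeriodPair.sumInvPow 0 (4 * k)) := by
  have hr : 3 ≤ 4 * k - 1 := by lia
  have i0 := (integrableOn_pow_mul_coneKernel 0 hr).div_const 2
  have i1 := (integrableOn_pow_mul_coneKernel 1 hr).div_const 4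
  have i2 := (integrableOn_pow_mul_coneKernel (-1) hr).div_const 4
  have hsplit : ∀ t : ℝ, (t : ℂ) ^ (4 * k - 1) * (Complex.exp (-t) * kernelF1 Complex.I t) =
      (t : ℂ) ^ (4 * k - 1) * coneKernel 0 t / 2 + (t : ℂ) ^ (4 * k - 1) * coneKernel 1 t / 4 +
        (t : ℂ) ^ (4 * k - 1) * coneKernel (-1) t / 4 := fun t => by
    rw [exp_mul_kernelF1]; ring
  obtain ⟨hs, ht⟩ := summable_and_tsum_gaussianInt (r := 4 * k) (by lia)
  have h4 := tsum_eq_four_mul_cone hs (by simp [gaussianInt, show k ≠ 0 by lia]) fun p => by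
    rw [gaussianInt_quarterTurn, mul_pow, pow_mul Complex.I, Complex.I_pow_four, one_pow, one_mul]
  simp only [hsplit]
  rw [integral_add (i0.fun_add i1) i2, integral_add i0 i1, integral_div, integral_div, integral_div,
    integral_pow_mul_coneKernel _ hr, integral_pow_mul_coneKernel _ hr,
    integral_pow_mul_coneKernel _ hr, ← ht, h4, Nat.sub_add_cancel (by lia)]
  ring

theorem hurwitzNumber_four_mul {k : ℕ} (hk : 1 ≤ k) :
    (4 : ℂ) ^ (2 * k - 1) / (8 * k) * hurwitzNumber (4 * k) =
      (4 * k - 1)! / 8 * lemniscatePeriodPair.sumInvPow 0 (4 * k) := by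
  obtain ⟨j, rfl⟩ : ∃ j, k = j + 1 := ⟨k - 1, by lia⟩
  rw [hurwitzNumber, PeriodPair.iteratedDeriv_weierstrassPExcept_self, if_neg (by lia),
    show 4 * (j + 1) - 2 + 1 = 4 * (j + 1) - 1 by lia, show 4 * (j + 1) - 2 + 2 = 4 * (j + 1) by lia,
    show 2 * (j + 1) - 1 = 2 * j + 1 by lia,
    show (2 : ℂ) ^ (4 * (j + 1)) = 4 * 4 ^ (2 * j + 1) by
      rw [show (4 : ℂ) = 2 ^ 2 by norm_num, ← pow_mul, ← pow_add]; ring_nf]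
  have hj : (j + 1 : ℂ) ≠ 0 := by exact_mod_cast Nat.succ_ne_zero j
  push_cast
  field_simp

/-! ### The constant and the recurrence -/

theorem hurwitzIntegrand_eq_sum (n : ℕ) {t : ℝ} (ht : 0 < t) :
    hurwitzIntegrand n t = ∑ k ∈ Finset.Icc 1 n,
      ((4 * n).choose (4 * k) : ℂ) / (lemniscatePeriod : ℂ) ^ (4 * k) *
        ((t : ℂ) ^ (4 * k - 1) * (Complex.exp (-t) * kernelF1 Complex.I t)) := by
  have ht0 : (t : ℂ) ≠ 0 := by exact_mod_cast ht.ne'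
  rw [hurwitzIntegrand, generalizedHypergeometric_quarters, neg_add_cancel_left, Finset.mul_sum]
  refine Finset.sum_congr rfl fun k hk => ?_
  have hk1 := (Finset.mem_Icc.1 hk).1
  have hpow : (t : ℂ) ^ (4 * k) = t ^ (4 * k - 1) * t := by
    rw [← pow_succ, Nat.sub_add_cancel (by lia)]
  rw [div_pow, ← pow_mul, ← pow_mul, hpow]
  field_simp

theorem integrableOn_hurwitzIntegrand (n : ℕ) : IntegrableOn (hurwitzIntegrand n) (Ioi (0 : ℝ)) := by
  refine IntegrableOn.congr_fun ?_ (fun t ht => (hurwitzIntegrand_eq_sum n ht).symm)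
    measurableSet_Ioi
  refine integrable_finsetSum _ fun k hk => Integrable.const_mul ?_ _
  exact integrableOn_pow_mul_exp_mul_kernelF1 (by have := (Finset.mem_Icc.1 hk).1; lia)

theorem hurwitzConstant_eq_sum (n : ℕ) :
    hurwitzConstant n = ∑ k ∈ Finset.Icc 1 n, ((4 * n).choose (4 * k) : ℂ) *
      ((4 : ℂ) ^ (2 * k - 1) / (8 * k)) * hurwitzNumber (4 * k) := by
  have hω : (lemniscatePeriod : ℂ) ≠ 0 := by exact_mod_cast lemniscatePeriod_pos.ne'
  rw [hurwitzConstant, setIntegral_congr_fun measurableSet_Ioi fun (t : ℝ) (ht : 0 < t) =>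
    hurwitzIntegrand_eq_sum n ht, integral_finsetSum]
  · refine Finset.sum_congr rfl fun k hk => ?_
    have hk1 := (Finset.mem_Icc.1 hk).1
    rw [integral_const_mul, integral_pow_mul_exp_mul_kernelF1 hk1, mul_assoc (Nat.cast _),
      hurwitzNumber_four_mul hk1]
    field_simp
  · intro k hk
    refine Integrable.const_mul ?_ _
    exact integrableOn_pow_mul_exp_mul_kernelF1 (by have := (Finset.mem_Icc.1 hk).1; lia)

theorem theorem15 (n : ℕ) (hn : 1 ≤ n) :
    IntegrableOn (hurwitzIntegrand n) (Ioi (0 : ℝ)) ∧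
      (4 : ℂ) ^ (2 * n - 1) / (8 * n) * hurwitzNumber (4 * n) =
        hurwitzConstant n -
          ∑ k ∈ Finset.Icc 1 (n - 1),
            ((4 * n).choose (4 * k) : ℂ) * ((4 : ℂ) ^ (2 * k - 1) / (8 * k)) *
              hurwitzNumber (4 * k) := by
  refine ⟨integrableOn_hurwitzIntegrand n, ?_⟩
  obtain ⟨m, rfl⟩ : ∃ m, n = m + 1 := ⟨n - 1, by lia⟩
  rw [hurwitzConstant_eq_sum, Nat.add_sub_cancel,
    Finset.sum_Icc_succ_top (by lia), add_sub_cancel_left, Nat.choose_self, Nat.cast_one, one_mul]
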